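/- Let $(\Phi_e)_{e\in\omega}$ be the usual effective list of Turing functionals, and for $f,g\in\omega^\omega$ let $\langle f,g\rangle\in\omega^\omega$ be given by $\langle f,g\rangle(2n)=f(n)$ and $\langle f,g\rangle(2n+1)=g(n)$. For multi-valued partial functions $\mathcal F,\mathcal G\colon\subseteq\omega^\omega\rightrightarrows\omega^\omega$, say that $\mathcal F$ Weihrauch reduces to $\mathcal G$, written $\mathcal F\leq_{\mathrm W}\mathcal G$, if there are Turing functionals $\Phi,\Psi\colon\subseteq\omega^\omega\to\omega^\omega$ such that $\Phi(f)\in\operatorname{dom}(\mathcal G)$ for all $f\in\operatorname{dom}(\mathcal F)$, and $\Psi(\langle f,g\rangle)\in\mathcal F(f)$ for all $f\in\operatorname{dom}(\mathcal F)$ and all $g\in\mathcal G(\Phi(f))$. Let $\mathsf{DNR}$ be the multi-valued function whose instances are all functions $p\in\omega^\omega$ and whose solutions to $p$ are all $f\in\omega^\omega$ that are diagonally non-recursive relative to $p$, i.e. such that for every $e$, if $\Phi_e(p)(e){\downarrow}$ then $f(e)\neq\Phi_e(p)(e)$. Let $\mathsf{wRSgr}$ (the refined weak Rival--Sands problem for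 graphs) be the multi-valued function whose instances are all infinite simple graphs $G=(V,E)$ with $V\subseteq\omega$ and whose solutions to $G$ are all infinite sets $H\subseteq V$ such that for every $v\in H$, with $N(v)$ the set of neighbors of $v$ in $G$, the set $H\cap N(v)$ is either infinite or empty. Here $G$ is coded as an element of $\omega^\omega$ by the pair $\langle\chi_V,\chi_E\rangle$ of characteristic functions, where $E$ is regarded as a set of coded pairs $(x,y)$ with $x<y$, and $H$ is coded by its characteristic function. Then $\mathsf{DNR}\nleq_{\mathrm W}\mathsf{wRSgr}$. -/

import Mathlib

/-- Programs for oracle computations on natural numbers: the usual programs for partial recursive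
functions together with an instruction `oracle` that queries the oracle. -/
inductive OracleCode : Type
  | zero : OracleCode
  | succ : OracleCode
  | left : OracleCode
  | right : OracleCode
  | oracle : OracleCode
  | pair : OracleCode → OracleCode → OracleCode
  | comp : OracleCode → OracleCode → OracleCode
  | prec : OracleCode → OracleCode → OracleCode
  | rfind : OracleCode → OracleCode

namespace OracleCode

/-- `eval c p n` is the result (if any) of running the program `c` with oracle `p` on input `n`.
The clauses are those of `Nat.RecursiveIn {p}`. -/
def eval : OracleCode → (ℕ → ℕ) → ℕ →. ℕ
  | zero, _ => fun _ => Part.some 0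
  | succ, _ => fun n => Part.some (n + 1)
  | left, _ => fun n => Part.some n.unpair.1
  | right, _ => fun n => Part.some n.unpair.2
  | oracle, p => fun n => Part.some (p n)
  | pair cf cg, p => fun n => Nat.pair <$> eval cf p n <*> eval cg p n
  | comp cf cg, p => fun n => eval cg p n >>= eval cf p
  | prec cf cg, p => Nat.unpaired fun a n =>
      n.rec (eval cf p a) fun y IH => do
        let i ← IH
        eval cg p (Nat.pair a (Nat.pair y i))
  | rfind cf, p => fun a => Nat.rfind fun n => (fun m => m = 0) <$> eval cf p (Nat.pair a n)

/-- The Gödel number of a program. -/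
def toIndex : OracleCode → ℕ
  | zero => 0
  | succ => 1
  | left => 2
  | right => 3
  | oracle => 4
  | pair cf cg => 4 * Nat.pair (toIndex cf) (toIndex cg) + 5
  | comp cf cg => 4 * Nat.pair (toIndex cf) (toIndex cg) + 6
  | prec cf cg => 4 * Nat.pair (toIndex cf) (toIndex cg) + 7
  | rfind cf => 4 * toIndex cf + 8

/-- The program with a given Gödel number. -/
def ofIndex : ℕ → OracleCode
  | 0 => zero
  | 1 => succ
  | 2 => left
  | 3 => right
  | 4 => oracle
  | n + 5 =>
    have hm : n / 4 < n + 5 := by omega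
    have _h1 : (n / 4).unpair.1 < n + 5 := lt_of_le_of_lt (n / 4).unpair_left_le hm
    have _h2 : (n / 4).unpair.2 < n + 5 := lt_of_le_of_lt (n / 4).unpair_right_le hm
    match n % 4 with
    | 0 => pair (ofIndex (n / 4).unpair.1) (ofIndex (n / 4).unpair.2)
    | 1 => comp (ofIndex (n / 4).unpair.1) (ofIndex (n / 4).unpair.2)
    | 2 => prec (ofIndex (n / 4).unpair.1) (ofIndex (n / 4).unpair.2)
    | _ => rfind (ofIndex (n / 4))

theorem ofIndex_toIndex (c : OracleCode) : ofIndex (toIndex c) = c := by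
  induction c with
  | zero | succ | left | right | oracle => simp [toIndex, ofIndex]
  | pair cf cg hf hg => simp [toIndex, ofIndex, hf, hg]
  | comp cf cg hf hg =>
    have h1 : ∀ m : ℕ, (4 * m + 1) / 4 = m := by omega
    have h2 : ∀ m : ℕ, (4 * m + 1) % 4 = 1 := by omega
    rw [toIndex, show ∀ m, 4 * m + 6 = (4 * m + 1) + 5 by omega, ofIndex]
    simp [h1, h2, hf, hg]
  | prec cf cg hf hg =>
    have h1 : ∀ m : ℕ, (4 * m + 2) / 4 = m := by omega
    have h2 : ∀ m : ℕ, (4 * m + 2) % 4 = 2 := by omega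
    rw [toIndex, show ∀ m, 4 * m + 7 = (4 * m + 2) + 5 by omega, ofIndex]
    simp [h1, h2, hf, hg]
  | rfind cf hf =>
    have h1 : ∀ m : ℕ, (4 * m + 3) / 4 = m := by omega
    have h2 : ∀ m : ℕ, (4 * m + 3) % 4 = 3 := by omega
    rw [toIndex, show ∀ m, 4 * m + 8 = (4 * m + 3) + 5 by omega, ofIndex]
    simp [h1, h2, hf]

/-- The Turing functional `Φ : ⊆ ω^ω → ω^ω` of a program: it is defined at `p` if the program with
oracle `p` halts on every input, and its value is then the function computed. -/
def functional (c : OracleCode) : (ℕ → ℕ) →. (ℕ → ℕ) :=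
  fun p => ⟨∀ n, (eval c p n).Dom, fun h n => (eval c p n).get (h n)⟩

end OracleCode

/-- `Phi e p n` is `Φ_e(p)(n)`, where `(Φ_e)` is the effective list of Turing functionals. -/
def Phi (e : ℕ) (p : ℕ → ℕ) : ℕ →. ℕ :=
  (OracleCode.ofIndex e).eval p

/-- The pairing `⟨f, g⟩` (also `f ⊕ g`), with `⟨f, g⟩(2n) = f(n)` and `⟨f, g⟩(2n+1) = g(n)`. -/
def joinFun (f g : ℕ → ℕ) : ℕ → ℕ :=
  fun n => if n % 2 = 0 then f (n / 2) else g (n / 2)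

/-- The characteristic function of a set of natural numbers. -/
noncomputable def charFun (A : Set ℕ) : ℕ → ℕ :=
  A.indicator fun _ => 1

/-- A multi-valued (partial) function `⊆ ω^ω ⇉ ω^ω`: a domain of instances and, for each
instance, a nonempty set of solutions. -/
structure MultiFun where
  dom : Set (ℕ → ℕ)
  sol : (ℕ → ℕ) → Set (ℕ → ℕ)
  sol_nonempty : ∀ f ∈ dom, (sol f).Nonempty

/-- Weihrauch reducibility `F ≤_W G`: there are Turing functionals `Φ, Ψ` such that `Φ(f)` is
defined and in `dom G` for all `f ∈ dom F`, and `Ψ(⟨f, g⟩)` is defined and in `F(f)` for all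
`f ∈ dom F` and `g ∈ G(Φ(f))`. -/
def WeihrauchReducible (F G : MultiFun) : Prop :=
  ∃ Φ Ψ : OracleCode, ∀ f ∈ F.dom, ∃ w ∈ Φ.functional f, w ∈ G.dom ∧
    ∀ g ∈ G.sol w, ∃ y ∈ Ψ.functional (joinFun f g), y ∈ F.sol f

/-- `f` is diagonally non-recursive relative to `p`. -/
def IsDNR (p f : ℕ → ℕ) : Prop :=
  ∀ e, ∀ y ∈ Phi e p e, f e ≠ y

theorem exists_isDNR (p : ℕ → ℕ) : ∃ f, IsDNR p f := by
  have h : ∀ e, ∃ z, ∀ y ∈ Phi e p e, z ≠ y := by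
    intro e
    by_cases hd : (Phi e p e).Dom
    · refine ⟨(Phi e p e).get hd + 1, fun y hy => ?_⟩
      rw [Part.get_eq_of_mem hy hd]
      omega
    · exact ⟨0, fun y hy => absurd (Part.dom_iff_mem.2 ⟨y, hy⟩) hd⟩
  choose f hf using h
  exact ⟨f, hf⟩

/-- The problem `DNR`: given `p`, find a function that is DNR relative to `p`. -/
def DNR : MultiFun where
  dom := Set.univ
  sol p := {f | IsDNR p f}
  sol_nonempty p _ := exists_isDNR p

/-- A simple graph `G = (V, E)` whose vertices are natural numbers, with `V = G.verts` a subset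
of `ℕ`, edge relation `G.Adj` and neighborhoods `N(x) = G.neighborSet x`. -/
abbrev NatGraph : Type := (⊤ : SimpleGraph ℕ).Subgraph

/-- The code of `G = (V, E)` in `ω^ω`: the pairing of the characteristic functions of `V` and of
`E`, the latter as a set of (coded) pairs `(x, y)` with `x < y`. -/
noncomputable def NatGraph.code (G : NatGraph) : ℕ → ℕ :=
  joinFun (charFun G.verts) (charFun {n | n.unpair.1 < n.unpair.2 ∧ G.Adj n.unpair.1 n.unpair.2})

/-- `H` is an infinite set of vertices such that every `v ∈ H` has either infinitely many
neighbors in `H` or none. -/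
def NatGraph.IsWRSgrSolution (G : NatGraph) (H : Set ℕ) : Prop :=
  H ⊆ G.verts ∧ H.Infinite ∧
    ∀ v ∈ H, (H ∩ G.neighborSet v).Infinite ∨ H ∩ G.neighborSet v = ∅

theorem NatGraph.exists_isWRSgrSolution (G : NatGraph) (hG : G.verts.Infinite) :
    ∃ H, G.IsWRSgrSolution H := by
  by_cases hF : {x ∈ G.verts | (G.neighborSet x).Finite}.Finite
  · refine ⟨G.verts \ {x ∈ G.verts | (G.neighborSet x).Finite}, Set.sdiff_subset, hG.sdiff hF,
      fun v hv => Or.inl ?_⟩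
    have hN : (G.neighborSet v).Infinite := fun h => hv.2 ⟨hv.1, h⟩
    refine (hN.sdiff hF).mono fun y hy => ⟨⟨G.edge_vert (G.adj_symm hy.1), hy.2⟩, hy.1⟩
  · obtain ⟨f, hP, hr⟩ := exists_seq_of_forall_finset_exists
      (fun x => x ∈ G.verts ∧ (G.neighborSet x).Finite) (fun x y => x < y ∧ ¬ G.Adj x y) (by
        intro s hs
        have hfin : (⋃ x ∈ s, (Set.Iic x ∪ G.neighborSet x)).Finite :=
          s.finite_toSet.biUnion fun x hx => (Set.finite_Iic x).union (hs x hx).2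
        obtain ⟨y, hy, hy'⟩ := (Set.Infinite.sdiff hF hfin).nonempty
        refine ⟨y, hy, fun x hx => ?_⟩
        simp only [Set.mem_iUnion, not_exists] at hy'
        have := hy' x hx
        simp only [Set.mem_union, Set.mem_Iic, not_or, not_le] at this
        exact this)
    have hmono : StrictMono f := fun m n hmn => (hr m n hmn).1
    refine ⟨Set.range f, ?_, Set.infinite_range_of_injective hmono.injective, ?_⟩
    · rintro _ ⟨n, rfl⟩
      exact (hP n).1
    · rintro _ ⟨m, rfl⟩
      refine Or.inr (Set.eq_empty_of_forall_notMem ?_)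
      rintro _ ⟨⟨n, rfl⟩, hn⟩
      rcases lt_trichotomy m n with h | h | h
      · exact (hr m n h).2 hn
      · subst h
        exact G.loopless.irrefl _ hn
      · exact (hr n m h).2 (G.adj_symm hn)

/-- The problem `wRSgr`: given (the code of) an infinite graph `G = (V, E)`, find (the
characteristic function of) an infinite `H ⊆ V` such that every `v ∈ H` has either infinitely many
neighbors in `H` or none. -/
def wRSgr : MultiFun where
  dom := {f | ∃ G : NatGraph, G.verts.Infinite ∧ f = G.code}
  sol f := {h | ∃ G : NatGraph, f = G.code ∧ ∃ H, G.IsWRSgrSolution H ∧ h = charFun H}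
  sol_nonempty := by
    rintro f ⟨G, hG, rfl⟩
    obtain ⟨H, hH⟩ := G.exists_isWRSgrSolution hG
    exact ⟨charFun H, G, rfl, H, hH, rfl⟩

open Filter Topology

/-! ### Continuity of oracle computations -/

/-! Let `Φ`, `Ψ` witness a reduction and let `g p` be the graph coded by `Φ(p)`. A program with
index `i` reads the first nonzero entry of column `e` of its oracle, so a DNR function relative to
`p` avoids at `i` the value revealed there. If `H` solves `g p` and column `e` of `p` is still zero,
then `a = Ψ(⟨p, H⟩)(i)` depends only on finite parts of `p` and `H`. Writing `a + 1` far out in that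
column preserves these and a finite part of the graph, but a finite part of `H` no longer continues
to a solution (`exists_not_extendible`). It remains to find an `H` whose finite parts always
continue.

Conditions consist of a finite string and columns promised to stay zero. Any finite set of vertices
can be decided: each is forced to have bounded degree, or no extension forces this. A finite
independent set of bounded vertices extends to a solution avoiding all its neighbors. An unbounded
vertex can be given large unbounded neighbors (`ForcesUnbdd.exists_adj`): otherwise infinitely many
of its neighbors form an independent solution whose finite parts, once decided, are bounded and so
continue. Iterating this, decided finite sets extend when their bounded vertices have no neighbors
in the set (`exists_solution_of_forces`).

In `not_avoidsRevealed`, `H` is an infinite independent set if large bounded vertices are dense;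
otherwise it is a solution avoiding small numbers, below a condition where large vertices stay
unbounded. -/

theorem exists_agree_of_eventually_nhds {p : ℕ → ℕ} {P : (ℕ → ℕ) → Prop} (h : ∀ᶠ q in 𝓝 p, P q) :
    ∃ s, ∀ q : ℕ → ℕ, (∀ k < s, q k = p k) → P q := by
  obtain ⟨U, hU, hUo, hp⟩ := eventually_nhds_iff.1 h
  obtain ⟨I, u, hu, hI⟩ := isOpen_pi_iff.1 hUo p hp
  refine ⟨I.sup id + 1, fun q hq => hU q (hI fun i hi => ?_)⟩
  rw [hq i (Nat.lt_succ_of_le (Finset.le_sup (f := id) hi))]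
  exact (hu i hi).2

theorem eventually_nhds_apply_eq (p : ℕ → ℕ) (n : ℕ) : ∀ᶠ q in 𝓝 p, q n = p n := by
  have h := (continuous_apply (A := fun _ : ℕ => ℕ) n).tendsto p
  rwa [nhds_discrete ℕ, tendsto_pure] at h

namespace OracleCode

theorem mem_eval_pair {cf cg : OracleCode} {p : ℕ → ℕ} {n a : ℕ} :
    a ∈ (pair cf cg).eval p n ↔ ∃ x ∈ cf.eval p n, ∃ y ∈ cg.eval p n, Nat.pair x y = a := by
  simp only [eval, Seq.seq, Part.map_eq_map, Part.mem_bind_iff, Part.mem_map_iff]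
  constructor
  · rintro ⟨_, ⟨x, hx, rfl⟩, y, hy, rfl⟩
    exact ⟨x, hx, y, hy, rfl⟩
  · rintro ⟨x, hx, y, hy, rfl⟩
    exact ⟨_, ⟨x, hx, rfl⟩, y, hy, rfl⟩

theorem mem_eval_comp {cf cg : OracleCode} {p : ℕ → ℕ} {n a : ℕ} :
    a ∈ (comp cf cg).eval p n ↔ ∃ x ∈ cg.eval p n, a ∈ cf.eval p x :=
  Part.mem_bind_iff

theorem mem_eval_prec_zero {cf cg : OracleCode} {p : ℕ → ℕ} {m a : ℕ} :
    a ∈ (prec cf cg).eval p (Nat.pair m 0) ↔ a ∈ cf.eval p m := by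
  simp [eval, Nat.unpaired]

theorem mem_eval_prec_succ {cf cg : OracleCode} {p : ℕ → ℕ} {m n a : ℕ} :
    a ∈ (prec cf cg).eval p (Nat.pair m (n + 1)) ↔
      ∃ i ∈ (prec cf cg).eval p (Nat.pair m n),
        a ∈ cg.eval p (Nat.pair m (Nat.pair n i)) := by
  simp [eval, Nat.unpaired]

theorem mem_eval_rfind {cf : OracleCode} {p : ℕ → ℕ} {n a : ℕ} :
    a ∈ (rfind cf).eval p n ↔
      0 ∈ cf.eval p (Nat.pair n a) ∧ ∀ m < a, ∃ y ∈ cf.eval p (Nat.pair n m), y ≠ 0 := by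
  refine Nat.mem_rfind.trans ?_
  simp [Part.mem_map_iff]

/-- The use principle: a halting computation makes only finitely many oracle queries. -/
theorem eventually_mem_eval (c : OracleCode) (p : ℕ → ℕ) :
    ∀ n a, a ∈ c.eval p n → ∀ᶠ q in 𝓝 p, a ∈ c.eval q n := by
  induction c with
  | zero | succ | left | right => exact fun n a h => Eventually.of_forall fun q => h
  | oracle =>
    intro n a h
    filter_upwards [eventually_nhds_apply_eq p n] with q hq
    simpa [eval, hq] using h
  | pair cf cg hf hg =>
    intro n a h
    obtain ⟨x, hx, y, hy, rfl⟩ := mem_eval_pair.1 h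
    filter_upwards [hf n x hx, hg n y hy] with q hx hy
    exact mem_eval_pair.2 ⟨x, hx, y, hy, rfl⟩
  | comp cf cg hf hg =>
    intro n a h
    obtain ⟨x, hx, ha⟩ := mem_eval_comp.1 h
    filter_upwards [hg n x hx, hf x a ha] with q hx ha
    exact mem_eval_comp.2 ⟨x, hx, ha⟩
  | prec cf cg hf hg =>
    intro n
    rw [← Nat.pair_unpair n]
    induction n.unpair.2 with
    | zero =>
      intro a h
      filter_upwards [hf _ a (mem_eval_prec_zero.1 h)] with q ha
      exact mem_eval_prec_zero.2 ha
    | succ m ih =>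
      intro a h
      obtain ⟨i, hi, ha⟩ := mem_eval_prec_succ.1 h
      filter_upwards [ih i hi, hg _ a ha] with q hi ha
      exact mem_eval_prec_succ.2 ⟨i, hi, ha⟩
  | rfind cf hf =>
    intro n a h
    obtain ⟨h0, h⟩ := mem_eval_rfind.1 h
    have hlt : ∀ᶠ q in 𝓝 p, ∀ m ∈ Finset.range a, ∃ y ∈ cf.eval q (Nat.pair n m), y ≠ 0 := by
      rw [Filter.eventually_all_finset]
      intro m hm
      obtain ⟨y, hy, hy0⟩ := h m (Finset.mem_range.1 hm)
      filter_upwards [hf _ y hy] with q hy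
      exact ⟨y, hy, hy0⟩
    filter_upwards [hf _ _ h0, hlt] with q h0 hlt
    exact mem_eval_rfind.2 ⟨h0, fun m hm => hlt m (Finset.mem_range.2 hm)⟩

end OracleCode

theorem OracleCode.eventually_mem_functional (c : OracleCode) {p w : ℕ → ℕ}
    (h : w ∈ c.functional p) (n : ℕ) : ∀ᶠ q in 𝓝 p, ∀ z ∈ c.functional q, z n = w n := by
  obtain ⟨hd, rfl⟩ := h
  filter_upwards [c.eventually_mem_eval p n _ (Part.get_mem (hd n))] with q hq
  rintro _ ⟨hd', rfl⟩
  exact Part.get_eq_of_mem hq _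

/-! ### A program that reads the value revealed in a column of the oracle -/

/-- The first nonzero entry in the column `e` of `p` is `a + 1`. -/
def Reveals (p : ℕ → ℕ) (e a : ℕ) : Prop :=
  ∃ t, p (Nat.pair e t) = a + 1 ∧ ∀ t' < t, p (Nat.pair e t') = 0

namespace OracleCode

/-- A program for the constant function with value `m`. -/
def const : ℕ → OracleCode
  | 0 => zero
  | m + 1 => comp succ (const m)

theorem mem_eval_const (m : ℕ) (p : ℕ → ℕ) (n : ℕ) : m ∈ (const m).eval p n := by
  induction m with
  | zero => exact Part.mem_some _
  | succ m ih => exact mem_eval_comp.2 ⟨m, ih, Part.mem_some _⟩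

theorem mem_eval_pair_left_right (p : ℕ → ℕ) (n : ℕ) : n ∈ (pair left right).eval p n :=
  mem_eval_pair.2 ⟨_, Part.mem_some _, _, Part.mem_some _, Nat.pair_unpair n⟩

/-- A program sending `0` to `m` and `n + 1` to the value of `c` at `⟨0, ⟨n, i⟩⟩`, where `i` is
the value of the program at `n`. -/
def natRec (m : ℕ) (c : OracleCode) : OracleCode :=
  comp (prec (const m) c) (pair zero (pair left right))

theorem mem_eval_natRec {m : ℕ} {c : OracleCode} {p f : ℕ → ℕ} (h0 : f 0 = m)
    (h : ∀ n, f (n + 1) ∈ c.eval p (Nat.pair 0 (Nat.pair n (f n)))) (n : ℕ) :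
    f n ∈ (natRec m c).eval p n := by
  refine mem_eval_comp.2 ⟨Nat.pair 0 n, mem_eval_pair.2
    ⟨0, Part.mem_some _, n, mem_eval_pair_left_right p n, rfl⟩, ?_⟩
  induction n with
  | zero =>
    rw [mem_eval_prec_zero, h0]
    exact mem_eval_const m p 0
  | succ n ih => exact mem_eval_prec_succ.2 ⟨f n, ih, h n⟩

/-- A program that finds the first nonzero entry in the column `e` of the oracle and returns its
predecessor. -/
def readColumn (e : ℕ) : OracleCode :=
  comp (comp (natRec 0 (comp left right)) oracle)
    (pair (const e) (rfind (comp (natRec 1 zero) (comp oracle (pair (const e) right)))))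

theorem mem_eval_readColumn {p : ℕ → ℕ} {e a : ℕ} (h : Reveals p e a) (n : ℕ) :
    a ∈ (readColumn e).eval p n := by
  obtain ⟨t, ht, hlt⟩ := h
  -- The first `natRec` is the predecessor. The second computes `1 - k`, which turns a nonzero entry
  -- into the zero that `rfind` looks for.
  have hpred : ∀ k, k - 1 ∈ (natRec 0 (comp left right)).eval p k :=
    mem_eval_natRec (f := fun k => k - 1) rfl fun k =>
      mem_eval_comp.2 ⟨Nat.pair k (k - 1), by simp [eval], by simp [eval]⟩
  have hzero : ∀ k, 1 - k ∈ (natRec 1 zero).eval p k :=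
    mem_eval_natRec (f := fun k => 1 - k) rfl fun k => by simp [eval]
  have htest : ∀ m, 1 - p (Nat.pair e m) ∈
      (comp (natRec 1 zero) (comp oracle (pair (const e) right))).eval p (Nat.pair n m) :=
    fun m => mem_eval_comp.2 ⟨_, mem_eval_comp.2 ⟨Nat.pair e m, mem_eval_pair.2
      ⟨e, mem_eval_const e p _, m, by simp [eval], rfl⟩, Part.mem_some _⟩, hzero _⟩
  refine mem_eval_comp.2 ⟨Nat.pair e t, mem_eval_pair.2 ⟨e, mem_eval_const e p n, t,
    mem_eval_rfind.2 ⟨?_, fun m hm => ⟨_, htest m, by simp [hlt m hm]⟩⟩, rfl⟩,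
    mem_eval_comp.2 ⟨a + 1, by simp [eval, ht], hpred (a + 1)⟩⟩
  simpa [ht] using htest t

end OracleCode

/-- The value of `readColumn e` does not depend on its input, so it can be run at its own index
without the recursion theorem. -/
theorem not_reveals_of_isDNR {p f : ℕ → ℕ} (h : IsDNR p f) (e : ℕ) :
    ¬ Reveals p e (f (OracleCode.readColumn e).toIndex) := by
  intro hr
  refine h (OracleCode.readColumn e).toIndex _ ?_ rfl
  rw [Phi, OracleCode.ofIndex_toIndex]
  exact OracleCode.mem_eval_readColumn hr _

/-! ### Extending finite independent sets to solutions -/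

/-- Only finitely many numbers are at most `u` or adjacent to `F`. A solution of the graph induced
on the other vertices can be joined to `F` without creating edges between the two. -/
theorem NatGraph.exists_isWRSgrSolution_extending (G : NatGraph) (hG : G.verts.Infinite)
    {F : Set ℕ} {u : ℕ} (hFu : ∀ x ∈ F, x ≤ u) (hFV : F ⊆ G.verts)
    (hF : ∀ x ∈ F, ∀ y ∈ F, ¬ G.Adj x y) (hfin : ∀ x ∈ F, (G.neighborSet x).Finite) :
    ∃ H, G.IsWRSgrSolution H ∧ ∀ k ≤ u, k ∈ H ↔ k ∈ F := by
  have hFfin : F.Finite := (Set.finite_Iic u).subset hFu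
  set B : Set ℕ := Set.Iic u ∪ ⋃ x ∈ F, G.neighborSet x with hB
  have hBfin : B.Finite := (Set.finite_Iic u).union (hFfin.biUnion hfin)
  obtain ⟨H, hHV, hHinf, hH⟩ := NatGraph.exists_isWRSgrSolution (G.induce (G.verts \ B))
    (hG.sdiff hBfin)
  have hHV : H ⊆ G.verts \ B := hHV
  have hHB : ∀ x ∈ F, ∀ y ∈ H, ¬ G.Adj x y := fun x hx y hy hxy =>
    (hHV hy).2 (Or.inr (Set.mem_biUnion hx hxy))
  refine ⟨H ∪ F, ⟨Set.union_subset (fun x hx => (hHV hx).1) hFV, hHinf.mono Set.subset_union_left,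
    ?_⟩, fun k hk => ⟨?_, Or.inr⟩⟩
  · rintro v (hv | hv)
    · have hN : (H ∪ F) ∩ G.neighborSet v = H ∩ (G.induce (G.verts \ B)).neighborSet v := by
        ext y
        constructor
        · rintro ⟨hy | hy, hvy⟩
          · exact ⟨hy, hHV hv, hHV hy, hvy⟩
          · exact absurd (G.adj_symm hvy) (hHB y hy v hv)
        · rintro ⟨hy, hvy⟩
          exact ⟨Or.inl hy, hvy.2.2⟩
      rw [hN]
      exact hH v hv
    · refine Or.inr (Set.eq_empty_of_forall_notMem ?_)
      rintro y ⟨hy | hy, hvy⟩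
      · exact hHB v hv y hy hvy
      · exact hF v hv y hy hvy
  · rintro (h | h)
    · exact absurd (Or.inl hk) (hHV h).2
    · exact h

/-! ### Conditions -/

/-- A forcing condition: a finite string (the values of `base` below `len`) and a finite set of
reserved columns, in which all later entries are promised to vanish. -/
structure Cond where
  base : ℕ → ℕ
  len : ℕ
  res : Finset ℕ

namespace Cond

/-- The set of sequences compatible with a condition. -/
def ext (c : Cond) : Set (ℕ → ℕ) :=
  {q | (∀ k < c.len, q k = c.base k) ∧ ∀ k, c.len ≤ k → k.unpair.1 ∈ c.res → q k = 0}

/-- The sequence compatible with a condition that vanishes past the finite string. -/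
def pt (c : Cond) : ℕ → ℕ := fun k => if k < c.len then c.base k else 0

theorem pt_mem (c : Cond) : c.pt ∈ c.ext :=
  ⟨fun _ hk => if_pos hk, fun _ hk _ => if_neg (Nat.not_lt.2 hk)⟩

/-- The condition obtained by lengthening the finite string to an initial segment of `q`. -/
def lengthen (c : Cond) (q : ℕ → ℕ) (n : ℕ) : Cond := ⟨q, n, c.res⟩

theorem lengthen_ext_subset {c : Cond} {q : ℕ → ℕ} (hq : q ∈ c.ext) {n : ℕ} (hn : c.len ≤ n) :
    (c.lengthen q n).ext ⊆ c.ext := by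
  rintro r ⟨h1, h2⟩
  refine ⟨fun k hk => (h1 k (hk.trans_le hn)).trans (hq.1 k hk), fun k hk hr => ?_⟩
  rcases lt_or_ge k n with h | h
  · exact (h1 k h).trans (hq.2 k hk hr)
  · exact h2 k h hr

theorem exists_lengthen (c : Cond) {q : ℕ → ℕ} (hq : q ∈ c.ext) {P : (ℕ → ℕ) → Prop}
    (hP : ∀ᶠ r in 𝓝 q, P r) (n : ℕ) :
    ∃ d : Cond, d.ext ⊆ c.ext ∧ n ≤ d.len ∧ ∀ r ∈ d.ext, P r := by
  obtain ⟨s, hs⟩ := exists_agree_of_eventually_nhds hP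
  refine ⟨c.lengthen q (max c.len (max n s)), lengthen_ext_subset hq (le_max_left _ _),
    (le_max_left n s).trans (le_max_right _ _), fun r hr => hs r fun k hk => hr.1 k ?_⟩
  exact hk.trans_le ((le_max_right n s).trans (le_max_right _ _))

/-- The condition obtained by reserving one more column. -/
def reserve (c : Cond) (e : ℕ) : Cond := ⟨c.base, c.len, insert e c.res⟩

theorem reserve_ext_subset (c : Cond) (e : ℕ) : (c.reserve e).ext ⊆ c.ext :=
  fun _ hq => ⟨hq.1, fun k hk hr => hq.2 k hk (Finset.mem_insert_of_mem hr)⟩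

/-- The column `e` is not reserved and does not meet the finite string. -/
def Fresh (c : Cond) (e : ℕ) : Prop := e ∉ c.res ∧ c.len ≤ e

theorem exists_fresh (c : Cond) : ∃ e, c.Fresh e := by
  refine ⟨max (c.res.sup id + 1) c.len, fun h => ?_, le_max_right _ _⟩
  have h1 := Finset.le_sup (f := id) h
  have h2 := le_max_left (c.res.sup id + 1) c.len
  simp only [id] at h1
  omega

/-- The limit takes its value at `k` from `d (k + 1)`, whose string is already longer than `k`. -/
theorem exists_mem_forall_ext (d : ℕ → Cond) (hd : ∀ i, (d (i + 1)).ext ⊆ (d i).ext)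
    (hlen : ∀ i, i ≤ (d i).len) : ∃ p, ∀ i, p ∈ (d i).ext := by
  have hanti : Antitone fun i => (d i).ext := antitone_nat_of_succ_le hd
  have hmem : ∀ {i j}, i ≤ j → (d j).pt ∈ (d i).ext := fun h => hanti h (pt_mem _)
  refine ⟨fun k => (d (k + 1)).pt k, fun i => ⟨fun k hk => ?_, fun k hk hr => ?_⟩⟩
  · rcases le_total i (k + 1) with h | h
    · exact (hmem h).1 k hk
    · have hk' : k < (d (k + 1)).len := hlen (k + 1)
      calc (d (k + 1)).pt k = (d (k + 1)).base k := if_pos hk'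
        _ = (d i).pt k := ((hmem h).1 k hk').symm
        _ = (d i).base k := if_pos hk
  · exact (hmem (((hlen i).trans hk).trans k.le_succ)).2 k hk hr

end Cond

/-! ### Forcing degrees to be finite or infinite -/

section Forcing

variable {g : (ℕ → ℕ) → NatGraph}

/-- The condition `c` forces the vertex `v` to have finite degree. -/
def ForcesBdd (g : (ℕ → ℕ) → NatGraph) (c : Cond) (v : ℕ) : Prop :=
  ∃ N, ∀ q ∈ c.ext, ∀ w, (g q).Adj v w → w ≤ N

/-- The condition `c` forces the vertex `v` to have infinite degree. -/
def ForcesUnbdd (g : (ℕ → ℕ) → NatGraph) (c : Cond) (v : ℕ) : Prop :=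
  ∀ d : Cond, d.ext ⊆ c.ext → ¬ ForcesBdd g d v

theorem ForcesBdd.mono {c d : Cond} {v : ℕ} (h : ForcesBdd g c v) (hd : d.ext ⊆ c.ext) :
    ForcesBdd g d v :=
  let ⟨N, hN⟩ := h
  ⟨N, fun q hq => hN q (hd hq)⟩

theorem ForcesUnbdd.mono {c d : Cond} {v : ℕ} (h : ForcesUnbdd g c v) (hd : d.ext ⊆ c.ext) :
    ForcesUnbdd g d v :=
  fun d' hd' => h d' (hd'.trans hd)

theorem ForcesUnbdd.not_forcesBdd {c : Cond} {v : ℕ} (h : ForcesUnbdd g c v) :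
    ¬ ForcesBdd g c v :=
  h c subset_rfl

theorem exists_forcesUnbdd_or_forcesBdd (g : (ℕ → ℕ) → NatGraph) (c : Cond) (F : Finset ℕ) :
    ∃ d : Cond, d.ext ⊆ c.ext ∧ ∀ v ∈ F, ForcesUnbdd g d v ∨ ForcesBdd g d v := by
  induction F using Finset.induction_on with
  | empty => exact ⟨c, subset_rfl, by simp⟩
  | insert v F _ ih =>
    obtain ⟨d, hdc, hd⟩ := ih
    by_cases hv : ForcesUnbdd g d v
    · refine ⟨d, hdc, fun w hw => ?_⟩
      rcases Finset.mem_insert.1 hw with rfl | hw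
      · exact Or.inl hv
      · exact hd w hw
    · simp only [ForcesUnbdd, not_forall, not_not] at hv
      obtain ⟨d', hsub, hv⟩ := hv
      refine ⟨d', hsub.trans hdc, fun w hw => ?_⟩
      rcases Finset.mem_insert.1 hw with rfl | hw
      · exact Or.inr hv
      · exact (hd w hw).imp (·.mono hsub) (·.mono hsub)

/-- If conditions forcing large vertices with the property `P` to have finite degree are dense
below `c`, then some graph compatible with `c` has an infinite independent set of such vertices. -/
theorem exists_infinite_independent {c : Cond} {P : Cond → ℕ → Prop}
    (h : ∀ d : Cond, d.ext ⊆ c.ext → ∀ m, ∃ d' : Cond, d'.ext ⊆ d.ext ∧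
      ∃ x > m, ForcesBdd g d' x ∧ P d' x) :
    ∃ p ∈ c.ext, ∃ H : Set ℕ, H.Infinite ∧ (∀ x ∈ H, ∀ y ∈ H, ¬ (g p).Adj x y) ∧
      ∀ x ∈ H, ∃ d : Cond, p ∈ d.ext ∧ P d x := by
  have step : ∀ s : {d : Cond // d.ext ⊆ c.ext} × ℕ, ∃ t : {d : Cond // d.ext ⊆ c.ext} × ℕ,
      t.1.1.ext ⊆ s.1.1.ext ∧ s.1.1.len < t.1.1.len ∧ ∃ x > s.2, x ≤ t.2 ∧
        (∀ q ∈ t.1.1.ext, ∀ w, (g q).Adj x w → w ≤ t.2) ∧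
        ∃ d : Cond, t.1.1.ext ⊆ d.ext ∧ P d x := by
    rintro ⟨⟨d, hd⟩, m⟩
    obtain ⟨d', hd', x, hx, ⟨N, hN⟩, hP⟩ := h d hd m
    have hsub := Cond.lengthen_ext_subset d'.pt_mem (le_max_left d'.len (d.len + 1))
    -- The new bound dominates `x` and all its possible neighbors, so later choices are not adjacent
    -- to `x`.
    refine ⟨⟨⟨_, (hsub.trans hd').trans hd⟩, max x N⟩, hsub.trans hd', ?_, x, hx, le_max_left _ _,
      fun q hq w hw => (hN q (hsub hq) w hw).trans (le_max_right _ _), d', hsub, hP⟩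
    exact (Nat.lt_succ_self _).trans_le (le_max_right d'.len (d.len + 1))
  choose next hsub hlen x hgt hle hbd hP using step
  let s : ℕ → {d : Cond // d.ext ⊆ c.ext} × ℕ := fun n => next^[n] (⟨c, subset_rfl⟩, 0)
  have hs : ∀ n, s (n + 1) = next (s n) := fun n => Function.iterate_succ_apply' next n _
  have hanti : ∀ i, (s (i + 1)).1.1.ext ⊆ (s i).1.1.ext := fun i => by
    rw [hs]
    exact hsub (s i)
  have hslen : ∀ i, i ≤ (s i).1.1.len := by
    intro i
    induction i with
    | zero => exact Nat.zero_le _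
    | succ i ih =>
      rw [hs]
      exact Nat.succ_le_of_lt (ih.trans_lt (hlen (s i)))
  obtain ⟨p, hp⟩ := Cond.exists_mem_forall_ext (fun i => (s i).1.1) hanti hslen
  have hp' : ∀ i, p ∈ (next (s i)).1.1.ext := fun i => hs i ▸ hp (i + 1)
  have hsmono : Monotone fun i => (s i).2 := monotone_nat_of_le_succ fun i => by
    rw [hs]
    exact (hgt (s i)).le.trans (hle (s i))
  have hlt : ∀ i j, i < j → (next (s i)).2 < x (s j) := fun i j hij => by
    have h1 : (s (i + 1)).2 ≤ (s j).2 := hsmono hij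
    rw [hs] at h1
    exact h1.trans_lt (hgt (s j))
  have hxmono : StrictMono fun i => x (s i) := fun i j hij => (hle (s i)).trans_lt (hlt i j hij)
  have hnadj : ∀ i j, i < j → ¬ (g p).Adj (x (s i)) (x (s j)) := fun i j hij hadj =>
    (hbd (s i) p (hp' i) _ hadj).not_gt (hlt i j hij)
  refine ⟨p, hp 0, Set.range fun i => x (s i), Set.infinite_range_of_injective hxmono.injective,
    ?_, ?_⟩
  · rintro _ ⟨i, rfl⟩ _ ⟨j, rfl⟩ hadj
    rcases lt_trichotomy i j with hij | hij | hij
    · exact hnadj i j hij hadj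
    · subst hij
      exact (g p).loopless.irrefl _ hadj
    · exact hnadj j i hij ((g p).adj_symm hadj)
  · rintro _ ⟨i, rfl⟩
    obtain ⟨d, hd, hPd⟩ := hP (s i)
    exact ⟨d, hd (hp' i), hPd⟩

/-! ### Diagonalizing against a solution -/

/-- The graph `g p` depends continuously on `p`. -/
def GraphContinuous (g : (ℕ → ℕ) → NatGraph) : Prop :=
  ∀ p, (∀ x, ∀ᶠ q in 𝓝 p, x ∈ (g q).verts ↔ x ∈ (g p).verts) ∧
    ∀ x y, ∀ᶠ q in 𝓝 p, (g q).Adj x y ↔ (g p).Adj x y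

/-- From every solution `H` of `g p` one can continuously read off, for each `e`, a value that is
not revealed in the column `e` of `p`. -/
def AvoidsRevealed (g : (ℕ → ℕ) → NatGraph) : Prop :=
  ∀ p H e, (g p).IsWRSgrSolution H → ∃ a s, ∀ q K, (∀ k < s, q k = p k) →
    (∀ k < s, k ∈ K ↔ k ∈ H) → (g q).IsWRSgrSolution K → ¬ Reveals q e a

/-- By revealing in a fresh column the value read off from a solution `H`, one passes to a
condition below which a finite part of `H` no longer extends to a solution. -/
theorem exists_not_extendible (hcont : GraphContinuous g) (hav : AvoidsRevealed g) {c : Cond}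
    {e : ℕ} (he : c.Fresh e) {p : ℕ → ℕ} (hp : p ∈ (c.reserve e).ext) {H : Set ℕ}
    (hH : (g p).IsWRSgrSolution H) (m : ℕ) :
    ∃ u ≥ m, ∃ d : Cond, d.ext ⊆ c.ext ∧
      (∀ q ∈ d.ext, ∀ x ≤ u, x ∈ (g q).verts ↔ x ∈ (g p).verts) ∧
      (∀ q ∈ d.ext, ∀ x ≤ u, ∀ y ≤ u, (g q).Adj x y ↔ (g p).Adj x y) ∧
      ¬ ∃ q ∈ d.ext, ∃ H', (g q).IsWRSgrSolution H' ∧ ∀ k ≤ u, k ∈ H' ↔ k ∈ H := by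
  have hfree : ∀ t, p (Nat.pair e t) = 0 := fun t => by
    have hle : c.len ≤ Nat.pair e t := he.2.trans (Nat.left_le_pair e t)
    exact hp.2 _ hle (by simp [Cond.reserve])
  obtain ⟨a, s, has⟩ := hav p H e hH
  set u := max m s with hu
  have hev : ∀ᶠ q in 𝓝 p, (∀ x ∈ Finset.Iic u, x ∈ (g q).verts ↔ x ∈ (g p).verts) ∧
      ∀ x ∈ Finset.Iic u, ∀ y ∈ Finset.Iic u, (g q).Adj x y ↔ (g p).Adj x y := by
    refine Eventually.and ?_ ?_
    · rw [eventually_all_finset]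
      exact fun x _ => (hcont p).1 x
    · rw [eventually_all_finset]
      intro x _
      rw [eventually_all_finset]
      exact fun y _ => (hcont p).2 x y
  obtain ⟨n, hn⟩ := exists_agree_of_eventually_nhds hev
  set t := max n s with ht
  set k₀ := Nat.pair e t with hk₀
  have htk : t ≤ k₀ := Nat.right_le_pair e t
  -- Returning to `c.res` drops the promise on column `e`, which served only to keep it zero in `p`.
  let d : Cond := ⟨Function.update p k₀ (a + 1), k₀ + 1, c.res⟩
  have hagree : ∀ q ∈ d.ext, ∀ k < k₀, q k = p k := fun q hq k hk => by
    rw [hq.1 k (Nat.lt_succ_of_lt hk)]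
    exact Function.update_of_ne hk.ne _ _
  have hupd : ∀ q ∈ d.ext, q k₀ = a + 1 := fun q hq => by
    rw [hq.1 k₀ (Nat.lt_succ_self _)]
    exact Function.update_self _ _ _
  have hpc : p ∈ c.ext := c.reserve_ext_subset e hp
  have hck : c.len ≤ k₀ := he.2.trans (Nat.left_le_pair e t)
  have hg : ∀ q ∈ d.ext, _ := fun q hq => hn q fun k hk =>
    hagree q hq k (hk.trans_le ((le_max_left n s).trans htk))
  refine ⟨u, le_max_left _ _, d, fun q hq => ⟨fun k hk => ?_, fun k hk hr => ?_⟩,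
    fun q hq x hx => (hg q hq).1 x (Finset.mem_Iic.2 hx),
    fun q hq x hx y hy => (hg q hq).2 x (Finset.mem_Iic.2 hx) y (Finset.mem_Iic.2 hy), ?_⟩
  · exact (hagree q hq k (hk.trans_le hck)).trans (hpc.1 k hk)
  · rcases lt_trichotomy k k₀ with h | h | h
    · exact (hagree q hq k h).trans (hpc.2 k hk hr)
    · rw [h, hk₀, Nat.unpair_pair] at hr
      exact absurd hr he.1
    · exact hq.2 k h hr
  · rintro ⟨q, hq, H', hH', hk⟩
    refine has q H' (fun k hk => hagree q hq k ?_) (fun k hks => hk k ?_) hH'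
      ⟨t, hupd q hq, fun t' ht' => ?_⟩
    · exact hk.trans_le ((le_max_right n s).trans htk)
    · exact hks.le.trans (le_max_right _ _)
    · rw [hagree q hq _ (Nat.pair_lt_pair_right e ht'), hfree]

/-! ### Continuing finite parts of solutions -/

theorem exists_solution_of_forcesBdd (hinf : ∀ p, (g p).verts.Infinite) {c : Cond} {u : ℕ}
    {F : Set ℕ} (hFu : ∀ x ∈ F, x ≤ u) (hFV : ∀ q ∈ c.ext, F ⊆ (g q).verts)
    (hF : ∀ q ∈ c.ext, ∀ x ∈ F, ∀ y ∈ F, ¬ (g q).Adj x y) (hbd : ∀ x ∈ F, ForcesBdd g c x) :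
    ∃ q ∈ c.ext, ∃ H, (g q).IsWRSgrSolution H ∧ ∀ k ≤ u, k ∈ H ↔ k ∈ F := by
  refine ⟨c.pt, c.pt_mem, NatGraph.exists_isWRSgrSolution_extending _ (hinf _) hFu
    (hFV _ c.pt_mem) (hF _ c.pt_mem) fun x hx => ?_⟩
  obtain ⟨N, hN⟩ := hbd x hx
  exact (Set.finite_Iic N).subset fun w hw => hN _ c.pt_mem w hw

/-- A vertex forced to have infinite degree can be given a large neighbor that is forced to have
infinite degree. -/
theorem ForcesUnbdd.exists_adj (hinf : ∀ p, (g p).verts.Infinite) (hcont : GraphContinuous g)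
    (hav : AvoidsRevealed g) {c : Cond} {v : ℕ} (hv : ForcesUnbdd g c v) (m : ℕ) :
    ∃ d : Cond, d.ext ⊆ c.ext ∧ ∃ x > m, ForcesUnbdd g d x ∧ ∀ q ∈ d.ext, (g q).Adj v x := by
  by_contra! hcon
  obtain ⟨e, he⟩ := c.exists_fresh
  have hdense : ∀ d : Cond, d.ext ⊆ (c.reserve e).ext → ∀ m', ∃ d' : Cond, d'.ext ⊆ d.ext ∧
      ∃ x > m', ForcesBdd g d' x ∧ x > m ∧ ∀ q ∈ d'.ext, (g q).Adj v x := by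
    intro d hd m'
    have hdc := hd.trans (c.reserve_ext_subset e)
    have hnb := hv d hdc
    simp only [ForcesBdd, not_exists, not_forall, not_le] at hnb
    obtain ⟨q, hq, w, hadj, hw⟩ := hnb (max m m')
    obtain ⟨d₁, hd₁, -, had⟩ := d.exists_lengthen hq ((hcont q).2 v w) 0
    have had : ∀ r ∈ d₁.ext, (g r).Adj v w := fun r hr => (had r hr).2 hadj
    -- By the contrary assumption a large neighbor of `v` is never forced unbounded, so some
    -- extension bounds it.
    have hnu : ¬ ForcesUnbdd g d₁ w := fun hu => by
      obtain ⟨r, hr, hr'⟩ := hcon d₁ (hd₁.trans hdc) w ((le_max_left _ _).trans_lt hw) hu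
      exact hr' (had r hr)
    simp only [ForcesUnbdd, not_forall, not_not] at hnu
    obtain ⟨d₂, hd₂, hb⟩ := hnu
    exact ⟨d₂, hd₂.trans hd₁, w, (le_max_right _ _).trans_lt hw, hb, (le_max_left _ _).trans_lt hw,
      fun r hr => had r (hd₂ hr)⟩
  obtain ⟨p, hp, H, hHinf, hind, hHP⟩ := exists_infinite_independent hdense
  have hHv : ∀ x ∈ H, x > m ∧ (g p).Adj v x := fun x hx =>
    let ⟨d, hpd, hxm, hd⟩ := hHP x hx
    ⟨hxm, hd p hpd⟩
  have hsol : (g p).IsWRSgrSolution H :=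
    ⟨fun x hx => (g p).edge_vert ((g p).adj_symm (hHv x hx).2), hHinf, fun x hx =>
      Or.inr (Set.eq_empty_of_forall_notMem fun y hy => hind x hx y hy.1 hy.2)⟩
  -- Asking for `u ≥ v` keeps the edges from `v` to the finite part of `H`, so `hcon` still applies
  -- to it.
  obtain ⟨u, hvu, d, hdc, hverts, hadj, hno⟩ := exists_not_extendible hcont hav he hp hsol v
  obtain ⟨d', hd', hdec⟩ := exists_forcesUnbdd_or_forcesBdd g d (Finset.Iic u)
  obtain ⟨q, hq, H', hH', hk⟩ := exists_solution_of_forcesBdd hinf (c := d') (u := u)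
    (F := {x ∈ H | x ≤ u}) (fun x hx => hx.2)
    (fun q hq x hx => (hverts q (hd' hq) x hx.2).2 (hsol.1 hx.1))
    (fun q hq x hx y hy h => hind x hx.1 y hy.1 ((hadj q (hd' hq) x hx.2 y hy.2).1 h))
    (fun x hx => (hdec x (Finset.mem_Iic.2 hx.2)).resolve_left fun hu => by
      obtain ⟨q, hq, h⟩ := hcon d' (hd'.trans hdc) x (hHv x hx.1).1 hu
      exact h ((hadj q (hd' hq) v hvu x hx.2).2 (hHv x hx.1).2))
  exact hno ⟨q, hd' hq, H', hH', fun k hku => (hk k hku).trans ⟨fun h => h.1, fun h => ⟨h, hku⟩⟩⟩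

theorem exists_forcesUnbdd_neighbors (hinf : ∀ p, (g p).verts.Infinite)
    (hcont : GraphContinuous g) (hav : AvoidsRevealed g) {c : Cond} {K : Finset ℕ}
    (hK : ∀ v ∈ K, ForcesUnbdd g c v) (m : ℕ) :
    ∃ d : Cond, d.ext ⊆ c.ext ∧ m ≤ d.len ∧ ∃ K' : Finset ℕ, K ⊆ K' ∧
      (∀ v ∈ K', ForcesUnbdd g d v) ∧ (∀ x ∈ K', x ∈ K ∨ m < x) ∧
      ∀ v ∈ K, ∃ x ∈ K', m < x ∧ ∀ q ∈ d.ext, (g q).Adj v x := by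
  suffices h : ∀ L ⊆ K, ∃ d : Cond, d.ext ⊆ c.ext ∧ m ≤ d.len ∧ ∃ K' : Finset ℕ, K ⊆ K' ∧
      (∀ v ∈ K', ForcesUnbdd g d v) ∧ (∀ x ∈ K', x ∈ K ∨ m < x) ∧
      ∀ v ∈ L, ∃ x ∈ K', m < x ∧ ∀ q ∈ d.ext, (g q).Adj v x from h K subset_rfl
  intro L
  induction L using Finset.induction_on with
  | empty =>
    intro _
    have hsub := Cond.lengthen_ext_subset c.pt_mem (le_max_left c.len m)
    exact ⟨_, hsub, le_max_right c.len m, K, subset_rfl, fun v hv => (hK v hv).mono hsub,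
      fun x hx => Or.inl hx, by simp⟩
  | insert v L _ ih =>
    intro hL
    obtain ⟨d, hdc, hlen, K', hKK', hun, hlarge, hL'⟩ :=
      ih ((Finset.subset_insert v L).trans hL)
    have hvK : v ∈ K := hL (Finset.mem_insert_self v L)
    obtain ⟨d₁, hd₁, x, hx, hxu, hadj⟩ :=
      (hun v (hKK' hvK)).exists_adj hinf hcont hav m
    have hsub := Cond.lengthen_ext_subset d₁.pt_mem (le_max_left d₁.len m)
    refine ⟨_, (hsub.trans hd₁).trans hdc, le_max_right d₁.len m, insert x K',
      hKK'.trans (Finset.subset_insert x K'), fun w hw => ?_, fun w hw => ?_, fun w hw => ?_⟩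
    · rcases Finset.mem_insert.1 hw with rfl | hw
      · exact hxu.mono hsub
      · exact (hun w hw).mono (hsub.trans hd₁)
    · rcases Finset.mem_insert.1 hw with rfl | hw
      · exact Or.inr hx
      · exact hlarge w hw
    · rcases Finset.mem_insert.1 hw with rfl | hw
      · exact ⟨x, Finset.mem_insert_self _ _, hx, fun q hq => hadj q (hsub hq)⟩
      · obtain ⟨y, hy, hmy, hya⟩ := hL' w hw
        exact ⟨y, Finset.mem_insert_of_mem hy, hmy, fun q hq => hya q (hd₁ (hsub hq))⟩

/-- A finite set of vertices forced to have infinite degree extends, above any bound, to a set in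
which every vertex has infinitely many neighbors. -/
theorem exists_forall_infinite_neighbors (hinf : ∀ p, (g p).verts.Infinite)
    (hcont : GraphContinuous g) (hav : AvoidsRevealed g) {c : Cond} {K : Finset ℕ}
    (hK : ∀ v ∈ K, ForcesUnbdd g c v) (m : ℕ) :
    ∃ p ∈ c.ext, ∃ I : Set ℕ, ↑K ⊆ I ∧ (∀ x ∈ I, x ∈ K ∨ m < x) ∧
      ∀ v ∈ I, (I ∩ (g p).neighborSet v).Infinite := by
  let S := {s : Cond × Finset ℕ // ∀ v ∈ s.2, ForcesUnbdd g s.1 v}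
  have step : ∀ (s : S) (i : ℕ), ∃ t : S, t.1.1.ext ⊆ s.1.1.ext ∧ i + 1 ≤ t.1.1.len ∧
      s.1.2 ⊆ t.1.2 ∧ (∀ x ∈ t.1.2, x ∈ s.1.2 ∨ m < x) ∧
      ∀ v ∈ s.1.2, ∃ x ∈ t.1.2, i < x ∧ ∀ q ∈ t.1.1.ext, (g q).Adj v x := by
    rintro ⟨⟨d, L⟩, hL⟩ i
    obtain ⟨d', hd', hlen, L', hLL', hun, hlarge, hadj⟩ :=
      exists_forcesUnbdd_neighbors hinf hcont hav hL (max m (i + 1))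
    refine ⟨⟨⟨d', L'⟩, hun⟩, hd', (le_max_right _ _).trans hlen, hLL',
      fun x hx => (hlarge x hx).imp_right (le_max_left m (i + 1)).trans_lt, fun v hv => ?_⟩
    obtain ⟨x, hx, hmx, h⟩ := hadj v hv
    exact ⟨x, hx, (Nat.lt_succ_self i).trans_le ((le_max_right m (i + 1)).trans hmx.le), h⟩
  choose next hsub hlen hmono hlarge hadj using step
  -- Stage `i` gives every vertex present a neighbor above `i`; in the limit each has infinitely
  -- many.
  let s : ℕ → S := fun n => Nat.rec ⟨⟨c, K⟩, hK⟩ (fun i t => next t i) n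
  have hlen' : ∀ i, i ≤ (s i).1.1.len := fun i => by
    cases i with
    | zero => exact Nat.zero_le _
    | succ i => exact hlen (s i) i
  obtain ⟨p, hp⟩ := Cond.exists_mem_forall_ext (fun i => (s i).1.1) (fun i => hsub (s i) i) hlen'
  have hKmono : Monotone fun i => (s i).1.2 := monotone_nat_of_le_succ fun i => hmono (s i) i
  refine ⟨p, hp 0, ⋃ i, ↑(s i).1.2, Set.subset_iUnion (fun i => (↑(s i).1.2 : Set ℕ)) 0, ?_, ?_⟩
  · intro x hx
    obtain ⟨i, hi⟩ := Set.mem_iUnion.1 hx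
    induction i with
    | zero => exact Or.inl hi
    | succ i ih => exact (hlarge (s i) i x hi).elim ih Or.inr
  · intro v hv
    obtain ⟨i, hi⟩ := Set.mem_iUnion.1 hv
    refine Set.infinite_of_forall_exists_gt fun n => ?_
    obtain ⟨x, hx, hxj, hvx⟩ := hadj (s (max i n)) (max i n) v (hKmono (le_max_left i n) hi)
    exact ⟨x, ⟨Set.mem_iUnion.2 ⟨max i n + 1, hx⟩, hvx p (hp (max i n + 1))⟩,
      (le_max_right i n).trans_lt hxj⟩

theorem exists_solution_of_forces (hinf : ∀ p, (g p).verts.Infinite) (hcont : GraphContinuous g)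
    (hav : AvoidsRevealed g) {c : Cond} {u : ℕ} {F : Set ℕ} (hFu : ∀ x ∈ F, x ≤ u)
    (hFV : ∀ q ∈ c.ext, F ⊆ (g q).verts) (hdec : ∀ x ∈ F, ForcesUnbdd g c x ∨ ForcesBdd g c x)
    (hF : ∀ q ∈ c.ext, ∀ x ∈ F, ForcesBdd g c x → ∀ y ∈ F, ¬ (g q).Adj x y) :
    ∃ q ∈ c.ext, ∃ H, (g q).IsWRSgrSolution H ∧ ∀ k ≤ u, k ∈ H ↔ k ∈ F := by
  classical
  -- An unbounded vertex is what makes `I` infinite below; without one, the extension must come from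
  -- elsewhere.
  by_cases hbd : ∀ x ∈ F, ForcesBdd g c x
  · exact exists_solution_of_forcesBdd hinf hFu hFV (fun q hq x hx => hF q hq x hx (hbd x hx)) hbd
  push Not at hbd
  obtain ⟨v₀, hv₀, hv₀b⟩ := hbd
  have hFfin : F.Finite := (Set.finite_Iic u).subset hFu
  set K : Finset ℕ := hFfin.toFinset.filter fun x => ForcesUnbdd g c x with hK
  have hKF : ∀ x, x ∈ K ↔ x ∈ F ∧ ForcesUnbdd g c x := fun x => by simp [hK]
  -- Vertices added above `N` are neither at most `u` nor adjacent to a bounded vertex of `F`.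
  have hN : ∃ N ≥ u, ∀ x ∈ F, ForcesBdd g c x → ∀ q ∈ c.ext, ∀ w, (g q).Adj x w → w ≤ N := by
    have : ∀ x, ∃ N, ForcesBdd g c x → ∀ q ∈ c.ext, ∀ w, (g q).Adj x w → w ≤ N := fun x => by
      by_cases h : ForcesBdd g c x
      · exact h.imp fun N hN _ => hN
      · exact ⟨0, fun h' => absurd h' h⟩
    choose N hN using this
    refine ⟨max u (hFfin.toFinset.sup N), le_max_left _ _, fun x hx hb q hq w hw => ?_⟩
    exact (hN x hb q hq w hw).trans
      ((Finset.le_sup (hFfin.mem_toFinset.2 hx)).trans (le_max_right _ _))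
  obtain ⟨N, huN, hN⟩ := hN
  obtain ⟨p, hp, I, hKI, hIlarge, hInf⟩ := exists_forall_infinite_neighbors hinf hcont hav
    (K := K) (fun v hv => ((hKF v).1 hv).2) N
  have hv₀I : v₀ ∈ I := hKI ((hKF v₀).2 ⟨hv₀, (hdec v₀ hv₀).resolve_right hv₀b⟩)
  refine ⟨p, hp, I ∪ F, ⟨?_, ?_, ?_⟩, fun k hk => ⟨?_, Or.inr⟩⟩
  · refine Set.union_subset (fun x hx => ?_) (hFV p hp)
    obtain ⟨y, -, hy⟩ := (hInf x hx).nonempty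
    exact (g p).edge_vert hy
  · exact (hInf v₀ hv₀I).mono fun x hx => Or.inl hx.1
  · intro v hv
    by_cases hvI : v ∈ I
    · exact Or.inl ((hInf v hvI).mono fun x hx => ⟨Or.inl hx.1, hx.2⟩)
    · have hvF : v ∈ F := hv.resolve_left hvI
      have hvb : ForcesBdd g c v := (hdec v hvF).resolve_left fun h =>
        hvI (hKI ((hKF v).2 ⟨hvF, h⟩))
      refine Or.inr (Set.eq_empty_of_forall_notMem ?_)
      rintro y ⟨hy, hvy⟩
      have hyF : y ∉ F := fun hyF => hF p hp v hvF hvb y hyF hvy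
      rcases hIlarge y (hy.resolve_right hyF) with h | h
      · exact hyF ((hKF y).1 h).1
      · exact h.not_ge (hN v hvF hvb p hp y hvy)
  · rintro (h | h)
    · rcases hIlarge k h with h | h
      · exact ((hKF k).1 h).1
      · exact absurd (hk.trans huN) h.not_ge
    · exact h

theorem not_avoidsRevealed (hinf : ∀ p, (g p).verts.Infinite) (hcont : GraphContinuous g) :
    ¬ AvoidsRevealed g := by
  intro hav
  let c : Cond := ⟨0, 0, ∅⟩
  have hc : c.Fresh 0 := ⟨Finset.notMem_empty 0, le_rfl⟩
  -- Membership in the graph is required because a number outside it has no neighbors at all.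
  by_cases h : ∀ d : Cond, d.ext ⊆ (c.reserve 0).ext → ∀ m, ∃ d' : Cond, d'.ext ⊆ d.ext ∧
      ∃ x > m, ForcesBdd g d' x ∧ ∀ q ∈ d'.ext, x ∈ (g q).verts
  · obtain ⟨p, hp, H, hHinf, hind, hHP⟩ := exists_infinite_independent h
    have hsol : (g p).IsWRSgrSolution H :=
      ⟨fun x hx => let ⟨d, hpd, hd⟩ := hHP x hx; hd p hpd, hHinf, fun x hx =>
        Or.inr (Set.eq_empty_of_forall_notMem fun y hy => hind x hx y hy.1 hy.2)⟩
    obtain ⟨u, -, d, -, hverts, hadj, hno⟩ := exists_not_extendible hcont hav hc hp hsol 0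
    obtain ⟨d', hd', hdec⟩ := exists_forcesUnbdd_or_forcesBdd g d (Finset.Iic u)
    obtain ⟨q, hq, H', hH', hk⟩ := exists_solution_of_forces hinf hcont hav (c := d') (u := u)
      (F := {x ∈ H | x ≤ u}) (fun x hx => hx.2)
      (fun q hq x hx => (hverts q (hd' hq) x hx.2).2 (hsol.1 hx.1))
      (fun x hx => hdec x (Finset.mem_Iic.2 hx.2))
      (fun q hq x hx _ y hy h => hind x hx.1 y hy.1 ((hadj q (hd' hq) x hx.2 y hy.2).1 h))
    exact hno ⟨q, hd' hq, H', hH', fun k hku => (hk k hku).trans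
      ⟨fun h => h.1, fun h => ⟨h, hku⟩⟩⟩
  · push Not at h
    obtain ⟨d, -, m, hd⟩ := h
    obtain ⟨e, he⟩ := d.exists_fresh
    -- Extending the empty set with bound `m` yields a solution with no element up to `m`.
    obtain ⟨p, hp, H, hsol, hHm⟩ := exists_solution_of_forcesBdd hinf (c := d.reserve e) (u := m)
      (F := ∅) (by simp) (by simp) (by simp) (by simp)
    obtain ⟨u, -, d', hd', hverts, -, hno⟩ := exists_not_extendible hcont hav he hp hsol 0
    have hun : ∀ x ∈ H, x ≤ u → ForcesUnbdd g d' x := fun x hx hxu d₂ hd₂ hb => by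
      have hxm : x > m := not_le.1 fun hxm => (hHm x hxm).1 hx
      obtain ⟨q, hq, hqx⟩ := hd d₂ (hd₂.trans hd') x hxm hb
      exact hqx ((hverts q (hd₂ hq) x hxu).2 (hsol.1 hx))
    obtain ⟨q, hq, H', hH', hk⟩ := exists_solution_of_forces hinf hcont hav (c := d') (u := u)
      (F := {x ∈ H | x ≤ u}) (fun x hx => hx.2)
      (fun q hq x hx => (hverts q hq x hx.2).2 (hsol.1 hx.1))
      (fun x hx => Or.inl (hun x hx.1 hx.2))
      (fun q hq x hx hb => absurd hb (hun x hx.1 hx.2).not_forcesBdd)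
    exact hno ⟨q, hq, H', hH', fun k hku => (hk k hku).trans ⟨fun h => h.1, fun h => ⟨h, hku⟩⟩⟩

end Forcing

/-! ### From a reduction to a continuous family of graphs -/

theorem charFun_eq_charFun_iff {A B : Set ℕ} {n : ℕ} :
    charFun A n = charFun B n ↔ (n ∈ A ↔ n ∈ B) := by
  classical
  simp only [charFun, Set.indicator_apply]
  by_cases hA : n ∈ A <;> by_cases hB : n ∈ B <;> simp [hA, hB]

theorem joinFun_two_mul (f g : ℕ → ℕ) (n : ℕ) : joinFun f g (2 * n) = f n := by
  simp [joinFun]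

theorem joinFun_two_mul_add_one (f g : ℕ → ℕ) (n : ℕ) : joinFun f g (2 * n + 1) = g n := by
  have h : (2 * n + 1) / 2 = n := by omega
  simp [joinFun, Nat.add_mod, h]

theorem joinFun_congr {f f' g g' : ℕ → ℕ} {s : ℕ} (hf : ∀ k < s, f' k = f k)
    (hg : ∀ k < s, g' k = g k) : ∀ k < s, joinFun f' g' k = joinFun f g k := fun k hk => by
  have h : k / 2 < s := (Nat.div_le_self k 2).trans_lt hk
  simp [joinFun, hf _ h, hg _ h]

theorem graphContinuous_of_functional {Φ : OracleCode} {g : (ℕ → ℕ) → NatGraph}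
    (hg : ∀ p, (g p).code ∈ Φ.functional p) : GraphContinuous g := by
  have hcode : ∀ p n, ∀ᶠ q in 𝓝 p, (g q).code n = (g p).code n := fun p n =>
    (Φ.eventually_mem_functional (hg p) n).mono fun q hq => hq _ (hg q)
  have hlt : ∀ p x y, x < y → ∀ᶠ q in 𝓝 p, (g q).Adj x y ↔ (g p).Adj x y := by
    intro p x y hxy
    filter_upwards [hcode p (2 * Nat.pair x y + 1)] with q hq
    rw [NatGraph.code, NatGraph.code, joinFun_two_mul_add_one, joinFun_two_mul_add_one,
      charFun_eq_charFun_iff] at hq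
    simpa [hxy] using hq
  refine fun p => ⟨fun x => ?_, fun x y => ?_⟩
  · filter_upwards [hcode p (2 * x)] with q hq
    rwa [NatGraph.code, NatGraph.code, joinFun_two_mul, joinFun_two_mul,
      charFun_eq_charFun_iff] at hq
  · rcases lt_trichotomy x y with h | rfl | h
    · exact hlt p x y h
    · exact Eventually.of_forall fun q =>
        iff_of_false ((g q).loopless.irrefl x) ((g p).loopless.irrefl x)
    · filter_upwards [hlt p y x h] with q hq
      rw [(g q).adj_comm, hq, (g p).adj_comm]

theorem mainTheorem7 : ¬ WeihrauchReducible DNR wRSgr := by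
  rintro ⟨Φ, Ψ, h⟩
  have h' : ∀ p, ∃ G : NatGraph, G.code ∈ Φ.functional p ∧ G.verts.Infinite ∧
      ∀ H, G.IsWRSgrSolution H → ∃ y ∈ Ψ.functional (joinFun p (charFun H)), IsDNR p y := by
    intro p
    obtain ⟨_, hw, ⟨G, hG, rfl⟩, hsol⟩ := h p (Set.mem_univ p)
    exact ⟨G, hw, hG, fun H hH => hsol _ ⟨G, rfl, H, hH, rfl⟩⟩
  choose g hg hinf hsol using h'
  refine not_avoidsRevealed hinf (graphContinuous_of_functional hg) fun p H e hH => ?_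
  obtain ⟨y, hy, -⟩ := hsol p H hH
  set i := (OracleCode.readColumn e).toIndex with hi
  obtain ⟨s, hs⟩ := exists_agree_of_eventually_nhds (Ψ.eventually_mem_functional hy i)
  -- Agreement below `s` makes `Ψ` output the same `y i` at `i`, which the DNR property for `p'`
  -- keeps from being revealed.
  refine ⟨y i, s, fun p' H' hp' hk hH' => ?_⟩
  obtain ⟨y', hy', hdnr⟩ := hsol p' H' hH'
  rw [← hs _ (joinFun_congr hp' fun k hks => charFun_eq_charFun_iff.2 (hk k hks)) y' hy']
  exact not_reveals_of_isDNR hdnr e
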